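/- Let $D_*$ be the sub-distribution monad on the category of sets: $D_*(X)$ is the set of finitely supported functions $t\colon X\to\mathbb{R}_{\ge 0}$ with $\sum_{x} t(x)\le 1$ (so $D_*(n)=\{t\in\mathbb{R}_{\ge0}^n : \sum_i t_i\le 1\}$); a map $f\colon X\to Y$ acts by push-forward, $(D_*f)(t)(y)=\sum_{f(x)=y}t(x)$; the unit sends $x$ to the point mass at $x$; and the multiplication sends $T\in D_*(D_*(X))$ to $\sum_{t}T(t)\,t$. Let $\mathrm{Mod}(D_*)$, the category of pointed convex spaces, be the Eilenberg–Moore category of algebras over $D_*$. In a category with a zero object, a pair of composable morphisms $X\xrightarrow{f}Y\xrightarrow{g}Z$ is called exact if $f$ is a kernel of $g$ and $g$ is a cokernel of $f$; in this case $f$ is called a strict monomorphism and $g$ a strict epimorphism. A category with a zero object in which every morphism has a kernel and a cokernel is called parabelian if (1) strict epimorphisms are closed under pullbacks along strict monomorphisms: for every strict monomorphism $f\colon X\to Y$ and every strict epimorphism $g\colon Y'\to Y$ there is a cartesian square with sides $f'\colon X'\to Y'$, $g'\colon X'\to X$, $gf'=fg'$, in which $g'$ is a strict epimorphism; (2) strict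 monomorphisms are closed under pushouts along strict epimorphisms: for every strict monomorphism $f'\colon X'\to Y'$ and every strict epimorphism $g'\colon X'\to X$ there is a cocartesian square with sides $f\colon X\to Y$, $g\colon Y'\to Y$, $gf'=fg'$, in which $f$ is a strict monomorphism. **Theorem.** The category $\mathrm{Mod}(D_*)$ of pointed convex spaces is parabelian. -/

import Mathlib

open CategoryTheory CategoryTheory.Limits
open scoped NNReal

universe u v w

/-! ## Exact pairs, strict mono- and epimorphisms, parabelian categories -/

section Parabelian

variable {C : Type u} [Category.{v} C] [HasZeroMorphisms C]

/-- A composable pair `X ⟶ Y ⟶ Z` is exact if `f` is a kernel of `g` and `g` is a cokernel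
of `f`. -/
def IsExactPair {X Y Z : C} (f : X ⟶ Y) (g : Y ⟶ Z) : Prop :=
  ∃ h : f ≫ g = 0,
    Nonempty (IsLimit (KernelFork.ofι f h)) ∧ Nonempty (IsColimit (CokernelCofork.ofπ g h))

/-- A strict monomorphism is the first member of an exact pair. -/
def IsStrictMono {X Y : C} (f : X ⟶ Y) : Prop :=
  ∃ (Z : C) (g : Y ⟶ Z), IsExactPair f g

/-- A strict epimorphism is the second member of an exact pair. -/
def IsStrictEpi {Y Z : C} (g : Y ⟶ Z) : Prop :=
  ∃ (X : C) (f : X ⟶ Y), IsExactPair f g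

end Parabelian

/-- A parabelian category: a category with a zero object, kernels and cokernels such that
strict epimorphisms are closed under pullbacks along strict monomorphisms, and strict
monomorphisms are closed under pushouts along strict epimorphisms.
(The zero morphisms of a category with a zero object are unique, and they are the composites
`X ⟶ 0 ⟶ Y`; so the first quantifier involves no choice.) -/
def IsParabelian (C : Type u) [Category.{v} C] : Prop :=
  ∃ _ : HasZeroMorphisms C,
    HasZeroObject C ∧ HasKernels C ∧ HasCokernels C ∧
    (∀ ⦃X Y Y' : C⦄ (f : X ⟶ Y) (g : Y' ⟶ Y), IsStrictMono f → IsStrictEpi g →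
      ∃ (X' : C) (f' : X' ⟶ Y') (g' : X' ⟶ X), IsPullback f' g' g f ∧ IsStrictEpi g') ∧
    (∀ ⦃X' X Y' : C⦄ (f' : X' ⟶ Y') (g' : X' ⟶ X), IsStrictMono f' → IsStrictEpi g' →
      ∃ (Y : C) (f : X ⟶ Y) (g : Y' ⟶ Y), IsPushout f' g' g f ∧ IsStrictMono f)

/-! ## The sub-distribution monad -/

/-- The total mass `∑ x, t x` of a finitely supported function, as a linear functional. -/
noncomputable def totalMass (X : Type w) : (X →₀ ℝ≥0) →ₗ[ℝ≥0] ℝ≥0 :=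
  Finsupp.linearCombination ℝ≥0 (fun _ : X => (1 : ℝ≥0))

theorem totalMass_apply {X : Type w} (t : X →₀ ℝ≥0) :
    totalMass X t = t.sum (fun _ r => r) := by
  simp [totalMass, Finsupp.linearCombination_apply]

theorem totalMass_single {X : Type w} (x : X) (r : ℝ≥0) :
    totalMass X (Finsupp.single x r) = r := by
  simp [totalMass]

theorem totalMass_mapDomain {X Y : Type w} (f : X → Y) (t : X →₀ ℝ≥0) :
    totalMass Y (t.mapDomain f) = totalMass X t := by
  simp [totalMass, Finsupp.linearCombination_mapDomain, Function.comp_def]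

/-- Finitely supported sub-distributions on `X`: functions `t : X → ℝ≥0` of finite support
with `∑ x, t x ≤ 1`. -/
def SubDist (X : Type w) : Type w :=
  {t : X →₀ ℝ≥0 // t.sum (fun _ r => r) ≤ 1}

namespace SubDist

theorem ext {X : Type w} {s t : SubDist X} (h : s.1 = t.1) : s = t :=
  Subtype.ext h

theorem totalMass_le {X : Type w} (t : SubDist X) : totalMass X t.1 ≤ 1 :=
  (totalMass_apply t.1).trans_le t.2

/-- Push-forward of sub-distributions: `(map f t) y = ∑ t x` over all `x` with `f x = y`. -/
noncomputable def map {X Y : Type w} (f : X → Y) (t : SubDist X) : SubDist Y :=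
  ⟨t.1.mapDomain f, by
    rw [← totalMass_apply, totalMass_mapDomain]; exact t.totalMass_le⟩

/-- The point mass at `x`. -/
noncomputable def unit {X : Type w} (x : X) : SubDist X :=
  ⟨Finsupp.single x 1, by rw [← totalMass_apply, totalMass_single]⟩

theorem totalMass_linearCombination_le {X : Type w} (T : SubDist (SubDist X)) :
    totalMass X (Finsupp.linearCombination ℝ≥0 (fun t : SubDist X => t.1) T.1) ≤ 1 := by
  have h : totalMass X (Finsupp.linearCombination ℝ≥0 (fun t : SubDist X => t.1) T.1)
      = T.1.sum (fun t r => r * totalMass X t.1) := by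
    rw [Finsupp.linearCombination_apply, map_finsuppSum]
    simp
  rw [h]
  refine le_trans ?_ T.2
  exact Finset.sum_le_sum fun t _ => mul_le_of_le_one_right' t.totalMass_le

/-- Flattening: `T ↦ ∑ t, T t • t`. -/
noncomputable def join {X : Type w} (T : SubDist (SubDist X)) : SubDist X :=
  ⟨Finsupp.linearCombination ℝ≥0 (fun t : SubDist X => t.1) T.1, by
    rw [← totalMass_apply]; exact totalMass_linearCombination_le T⟩

theorem map_id' {X : Type w} (t : SubDist X) : map (fun x => x) t = t :=
  ext Finsupp.mapDomain_id

theorem map_map {X Y Z : Type w} (f : X → Y) (g : Y → Z) (t : SubDist X) :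
    map g (map f t) = map (fun x => g (f x)) t :=
  ext Finsupp.mapDomain_comp.symm

theorem map_unit {X Y : Type w} (f : X → Y) (x : X) : map f (unit x) = unit (f x) :=
  ext Finsupp.mapDomain_single

theorem map_join {X Y : Type w} (f : X → Y) (T : SubDist (SubDist X)) :
    map f (join T) = join (map (map f) T) := by
  apply ext
  change Finsupp.lmapDomain ℝ≥0 ℝ≥0 f (Finsupp.linearCombination ℝ≥0 _ T.1)
    = Finsupp.linearCombination ℝ≥0 _ (Finsupp.mapDomain (map f) T.1)
  rw [Finsupp.linearCombination_mapDomain, Finsupp.apply_linearCombination]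
  rfl

theorem join_unit {X : Type w} (t : SubDist X) : join (unit t) = t := by
  apply ext
  simp [join, unit]

theorem join_map_unit {X : Type w} (t : SubDist X) : join (map unit t) = t := by
  apply ext
  change Finsupp.linearCombination ℝ≥0 _ (Finsupp.mapDomain unit t.1) = t.1
  rw [Finsupp.linearCombination_mapDomain, Finsupp.linearCombination_apply]
  simp [unit]

theorem join_map_join {X : Type w} (T : SubDist (SubDist (SubDist X))) :
    join (map join T) = join (join T) := by
  apply ext
  change Finsupp.linearCombination ℝ≥0 _ (Finsupp.mapDomain join T.1)
    = Finsupp.linearCombination ℝ≥0 _ (Finsupp.linearCombination ℝ≥0 _ T.1)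
  rw [Finsupp.linearCombination_mapDomain, Finsupp.apply_linearCombination]
  rfl

end SubDist

/-- The sub-distribution monad `D_*` on the category of sets. -/
noncomputable def subDistMonad : CategoryTheory.Monad (Type w) where
  obj X := SubDist X
  map f := ↾(SubDist.map f)
  map_id X := by ext t; exact SubDist.map_id' t
  map_comp f g := by ext t; exact (SubDist.map_map f g t).symm
  η :=
    { app := fun X => ↾(SubDist.unit (X := X))
      naturality := fun X Y f => by ext x; exact (SubDist.map_unit f x).symm }
  μ :=
    { app := fun X => ↾(SubDist.join (X := X))
      naturality := fun X Y f => by ext T; exact (SubDist.map_join f T).symm }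
  assoc X := by ext T; exact SubDist.join_map_join T
  left_unit X := by ext t; exact SubDist.join_unit t
  right_unit X := by ext t; exact SubDist.join_map_unit t

/-- The category `Mod(D_*)` of pointed convex spaces: the Eilenberg-Moore category of algebras
over the sub-distribution monad, with homomorphisms of algebras. -/
abbrev PointedConvexSpace : Type (w + 1) :=
  (subDistMonad.{w}).Algebra

/-! In `Mod(D_*)` a kernel is the fibre over the base point, and a cokernel is the quotient by the
congruence generated by collapsing the image to the base point. Both parabelian axioms reduce to one
statement, `collapse_of_collapse_ker`: if `X` is the kernel of `h : Y ⟶ Z` and `K` is the image of a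
morphism into `X`, then points of `X` that are congruent in `Y` modulo `K` are already congruent in
`X` modulo `K`.

The congruence is made of chains of elementary moves `p z + q a ↔ p z` with `a ∈ K`. Since `h`
vanishes on `K`, it is constant along a chain, so a chain starting in `X` stays in `X`. But the
auxiliary point `z` may lie outside `X`: the move only gives `p h(z) = 0`. By
`sc_eq_zero_of_sc_eq_zero` this forces `s h(z) = 0` for all `s < 1`, so `s z` lies in `X`. For `s`
close to `1` the move splits into two moves inside `X` (`collapse_of_kills`).

For the pullback axiom, with `f` a kernel of `p`, the pullback of `g` along `f` is the kernel of `g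
≫ p`, and the statement shows that its map to `X` is a cokernel. For the pushout axiom, the pushout
is a quotient of `Y'`, and the statement shows that `X` embeds in it. -/

namespace PointedConvexSpace

/-! ### Calculus of finite combinations -/

/-- The structure map of a pointed convex space, as a function. -/
def cmb (A : PointedConvexSpace.{w}) (t : SubDist A.A) : A.A := A.a t

/-- The function underlying a homomorphism. -/
def fn {A B : PointedConvexSpace.{w}} (f : A ⟶ B) (x : A.A) : B.A := f.f x

theorem cmb_unit (A : PointedConvexSpace.{w}) (x : A.A) : cmb A (SubDist.unit x) = x :=
  ConcreteCategory.congr_hom A.unit x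

theorem cmb_join (A : PointedConvexSpace.{w}) (T : SubDist (SubDist A.A)) :
    cmb A (SubDist.join T) = cmb A (SubDist.map (cmb A) T) := by
  have h : (subDistMonad.{w}).μ.app A.A ≫ A.a = (subDistMonad.{w}).map A.a ≫ A.a := A.assoc
  exact congrArg (fun φ : (subDistMonad.{w}).obj ((subDistMonad.{w}).obj A.A) ⟶ A.A => φ T) h

theorem fn_cmb {A B : PointedConvexSpace.{w}} (f : A ⟶ B) (t : SubDist A.A) :
    fn f (cmb A t) = cmb B (SubDist.map (fn f) t) :=
  (ConcreteCategory.congr_hom f.h t).symm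

theorem hom_ext {A B : PointedConvexSpace.{w}} {f g : A ⟶ B} (h : ∀ x, fn f x = fn g x) :
    f = g := by
  apply Monad.Algebra.Hom.ext'
  ext x
  exact h x

theorem fn_comp {A B C : PointedConvexSpace.{w}} (f : A ⟶ B) (g : B ⟶ C) (x : A.A) :
    fn (f ≫ g) x = fn g (fn f x) := rfl

/-- A pointed convex space from a type with an operation satisfying the laws of an algebra. -/
noncomputable def mk (X : Type w) (c : SubDist X → X) (hu : ∀ x, c (SubDist.unit x) = x)
    (hj : ∀ T, c (SubDist.join T) = c (SubDist.map c T)) : PointedConvexSpace.{w} where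
  A := X
  a := ↾c
  unit := by ext x; exact hu x
  assoc := by ext T; exact hj T

/-- A homomorphism from a function commuting with the structure maps. -/
def homMk {A B : PointedConvexSpace.{w}} (f : A.A → B.A)
    (h : ∀ t, f (cmb A t) = cmb B (SubDist.map f t)) : A ⟶ B where
  f := ↾f
  h := by ext t; exact (h t).symm

/-- The value in `A` of a finitely supported function of mass at most one
(an arbitrary value if the mass exceeds one). -/
noncomputable def ev (A : PointedConvexSpace.{w}) (v : A.A →₀ ℝ≥0) : A.A :=
  open Classical in
  if h : totalMass A.A v ≤ 1 then cmb A ⟨v, (totalMass_apply v).symm.trans_le h⟩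
  else cmb A ⟨0, by simp⟩

theorem cmb_eq_ev (A : PointedConvexSpace.{w}) (t : SubDist A.A) : cmb A t = ev A t.1 := by
  rw [ev, dif_pos t.totalMass_le]; rfl

/-- The base point. -/
noncomputable def zero (A : PointedConvexSpace.{w}) : A.A := ev A 0

theorem ev_single_one (A : PointedConvexSpace.{w}) (x : A.A) : ev A (Finsupp.single x 1) = x := by
  exact (cmb_eq_ev A (SubDist.unit x)).symm.trans (cmb_unit A x)

theorem fn_ev {A B : PointedConvexSpace.{w}} (f : A ⟶ B) {v : A.A →₀ ℝ≥0}
    (hv : totalMass A.A v ≤ 1) : fn f (ev A v) = ev B (v.mapDomain (fn f)) := by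
  let t : SubDist A.A := ⟨v, (totalMass_apply v).symm.trans_le hv⟩
  exact (congrArg (fn f) (cmb_eq_ev A t)).symm.trans ((fn_cmb f t).trans (cmb_eq_ev B _))

theorem fn_zero {A B : PointedConvexSpace.{w}} (f : A ⟶ B) : fn f (zero A) = zero B := by
  rw [zero, fn_ev f (by simp), Finsupp.mapDomain_zero]; rfl

theorem totalMass_linearCombination {ι : Type*} {X : Type w} (w : ι → X →₀ ℝ≥0) (T : ι →₀ ℝ≥0) :
    totalMass X (Finsupp.linearCombination ℝ≥0 w T) = T.sum fun i r => r * totalMass X (w i) := by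
  rw [Finsupp.linearCombination_apply, map_finsuppSum]
  simp

/-- Associativity: a combination of values is the value of the combination. -/
theorem ev_bind (A : PointedConvexSpace.{w}) {ι : Type*} (T : ι →₀ ℝ≥0)
    (hT : T.sum (fun _ r => r) ≤ 1) (w : ι → A.A →₀ ℝ≥0) (hw : ∀ i, totalMass A.A (w i) ≤ 1) :
    ev A (T.mapDomain fun i => ev A (w i)) = ev A (Finsupp.linearCombination ℝ≥0 w T) := by
  let W : ι → SubDist A.A := fun i => ⟨w i, (totalMass_apply _).symm.trans_le (hw i)⟩
  have hS : (T.mapDomain W).sum (fun _ r => r) ≤ 1 := by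
    rwa [Finsupp.sum_mapDomain_index (fun _ => rfl) (fun _ _ _ => rfl)]
  have := cmb_join A ⟨T.mapDomain W, hS⟩
  rw [cmb_eq_ev, cmb_eq_ev] at this
  change ev A (Finsupp.linearCombination ℝ≥0 _ (Finsupp.mapDomain W T)) =
    ev A (Finsupp.mapDomain _ (Finsupp.mapDomain W T)) at this
  rw [Finsupp.linearCombination_mapDomain, ← Finsupp.mapDomain_comp] at this
  refine Eq.trans ?_ this.symm
  congr 2
  funext i
  exact (cmb_eq_ev A (W i)).symm

/-- The combination `p x + q y`, for `p + q ≤ 1`. -/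
noncomputable def bin (A : PointedConvexSpace.{w}) (p : ℝ≥0) (x : A.A) (q : ℝ≥0) (y : A.A) : A.A :=
  ev A (Finsupp.single x p + Finsupp.single y q)

/-- The scalar multiple `p x`, for `p ≤ 1`. -/
noncomputable def sc (A : PointedConvexSpace.{w}) (p : ℝ≥0) (x : A.A) : A.A :=
  ev A (Finsupp.single x p)

/-- The case of `ev_bind` indexed by `Bool`. It turns identities between nested combinations into
identities between finitely supported functions. -/
theorem bin_ev (A : PointedConvexSpace.{w}) {p q : ℝ≥0} (h : p + q ≤ 1) {v w : A.A →₀ ℝ≥0}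
    (hv : totalMass A.A v ≤ 1) (hw : totalMass A.A w ≤ 1) :
    bin A p (ev A v) q (ev A w) = ev A (p • v + q • w) := by
  have := ev_bind A (ι := Bool) (Finsupp.single true p + Finsupp.single false q)
    (by rw [Finsupp.sum_add_index' (fun _ => rfl) (fun _ _ _ => rfl)]; simpa using h)
    (fun b => cond b v w) (by intro b; cases b <;> assumption)
  rw [Finsupp.mapDomain_add, Finsupp.mapDomain_single, Finsupp.mapDomain_single, map_add,
    Finsupp.linearCombination_single, Finsupp.linearCombination_single] at this
  exact this

theorem sc_ev (A : PointedConvexSpace.{w}) {p : ℝ≥0} (h : p ≤ 1) {v : A.A →₀ ℝ≥0}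
    (hv : totalMass A.A v ≤ 1) : sc A p (ev A v) = ev A (p • v) := by
  have := bin_ev A (q := 0) (by simpa using h) hv hv
  simpa [bin, sc] using this

theorem fn_bin {A B : PointedConvexSpace.{w}} (f : A ⟶ B) {p q : ℝ≥0} (h : p + q ≤ 1)
    (x y : A.A) : fn f (bin A p x q y) = bin B p (fn f x) q (fn f y) := by
  rw [bin, fn_ev f (by simpa [totalMass_single] using h), Finsupp.mapDomain_add,
    Finsupp.mapDomain_single, Finsupp.mapDomain_single]
  rfl

theorem fn_sc {A B : PointedConvexSpace.{w}} (f : A ⟶ B) {p : ℝ≥0} (h : p ≤ 1)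
    (x : A.A) : fn f (sc A p x) = sc B p (fn f x) := by
  rw [sc, fn_ev f (by simpa [totalMass_single] using h), Finsupp.mapDomain_single]
  rfl

theorem sc_zero (A : PointedConvexSpace.{w}) {p : ℝ≥0} (h : p ≤ 1) : sc A p (zero A) = zero A := by
  rw [zero, sc_ev A h (by simp), smul_zero]

theorem zero_sc (A : PointedConvexSpace.{w}) (x : A.A) : sc A 0 x = zero A := by
  simp [sc, zero]

theorem sc_sc (A : PointedConvexSpace.{w}) {p q : ℝ≥0} (hp : p ≤ 1) (hq : q ≤ 1) (x : A.A) :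
    sc A p (sc A q x) = sc A (p * q) x := by
  conv_lhs => rw [sc.eq_def A q, sc_ev A hp (by simpa [totalMass_single] using hq)]
  simp [sc]

theorem bin_zero_right (A : PointedConvexSpace.{w}) {p q : ℝ≥0} (h : p + q ≤ 1) (x : A.A) :
    bin A p x q (zero A) = sc A p x := by
  have := bin_ev A h (v := Finsupp.single x 1) (w := 0) (by simp [totalMass_single]) (by simp)
  rw [ev_single_one] at this
  simpa [sc, zero] using this

/-- If `r x` is zero for some `r > 0`, then so is `s x` for every `s < 1`. -/
theorem sc_eq_zero_of_sc_eq_zero (A : PointedConvexSpace.{w}) {r s : ℝ≥0} (hr : 0 < r) (hr1 : r < 1)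
    (hs : s < 1) {x : A.A} (h : sc A r x = zero A) : sc A s x = zero A := by
  -- Put `u n = 1 - (1 - r) ^ n`. Then `u (n+1) x = u n x + (1 - u n) (r x)`, and the last term
  -- vanishes because `r x` is the base point. Since `u n` tends to `1`, it eventually exceeds `s`.
  have key : ∀ n : ℕ, ∃ u, u + (1 - r) ^ n = 1 ∧ sc A u x = zero A := by
    intro n
    induction n with
    | zero => exact ⟨0, by simp, zero_sc A x⟩
    | succ n ih =>
      obtain ⟨u, hu, hux⟩ := ih
      have hrd : r + (1 - r) = 1 := add_tsub_cancel_of_le hr1.le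
      refine ⟨u + (1 - r) ^ n * r, ?_, ?_⟩
      · rw [pow_succ, add_assoc, ← mul_add, hrd, mul_one, hu]
      · have hb := bin_ev A hu.le (v := Finsupp.single x 1) (w := Finsupp.single x r)
          (by simp [totalMass_single]) (by simpa [totalMass_single] using hr1.le)
        rw [ev_single_one, ← sc.eq_def, h, bin_zero_right A hu.le, hux] at hb
        rw [hb, sc, Finsupp.single_add]
        simp
  obtain ⟨n, hn⟩ := exists_pow_lt_of_lt_one (tsub_pos_of_lt hs) (tsub_lt_self zero_lt_one hr)
  obtain ⟨u, hu, hux⟩ := key n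
  have hsu : s < u := by
    have h1 : s + (1 - s) = 1 := add_tsub_cancel_of_le hs.le
    by_contra hc
    have := add_lt_add_of_le_of_lt (not_lt.mp hc) hn
    rw [hu, h1] at this
    exact lt_irrefl _ this
  have hu0 : u ≠ 0 := (zero_le.trans_lt hsu).ne'
  have hu1 : u ≤ 1 := hu ▸ le_self_add
  rw [← div_mul_cancel₀ s hu0, ← sc_sc A (div_le_one_of_le₀ hsu.le zero_le) hu1, hux,
    sc_zero A (div_le_one_of_le₀ hsu.le zero_le)]

/-! ### Zero morphisms and kernels -/

noncomputable instance : HasZeroMorphisms PointedConvexSpace.{w} where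
  zero A B := ⟨homMk (fun _ => zero B) fun t => by
    rw [cmb_eq_ev]
    have h := sc_ev B t.totalMass_le (v := 0) (by simp)
    rw [smul_zero] at h
    have hm : Finsupp.single (zero B) (totalMass A.A t.1) =
        Finsupp.mapDomain (fun _ => zero B) t.1 := by
      rw [totalMass_apply, Finsupp.mapDomain, ← Finsupp.single_sum]
    exact h.symm.trans (congrArg (ev B) hm)⟩
  comp_zero _ _ := rfl
  zero_comp _ _ _ f := hom_ext fun _ => fn_zero f

theorem fn_zero_hom {A B : PointedConvexSpace.{w}} (x : A.A) : fn (0 : A ⟶ B) x = zero B := rfl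

/-- The subspace of elements sent to the base point. -/
noncomputable def ker {A B : PointedConvexSpace.{w}} (f : A ⟶ B) : PointedConvexSpace.{w} :=
  mk {x : A.A // fn f x = zero B}
    (fun t => ⟨cmb A (SubDist.map Subtype.val t), by
      rw [fn_cmb, SubDist.map_map]
      have : (fun x : {x : A.A // fn f x = zero B} => fn f x.1) = fun _ => zero B :=
        funext fun x => x.2
      rw [this, ← SubDist.map_map Subtype.val (fun _ => zero B)]
      exact (fn_cmb (0 : A ⟶ B) _).symm⟩)
    (fun x => Subtype.ext (by simp only [SubDist.map_unit, cmb_unit]))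
    (fun T => Subtype.ext (by
      simp only [SubDist.map_join, cmb_join, SubDist.map_map]))

/-- The inclusion of the kernel. -/
noncomputable def kerι {A B : PointedConvexSpace.{w}} (f : A ⟶ B) : ker f ⟶ A :=
  homMk (A := ker f) Subtype.val fun _ => rfl

theorem kerι_injective {A B : PointedConvexSpace.{w}} (f : A ⟶ B) :
    Function.Injective (fn (kerι f)) := Subtype.val_injective

theorem exists_kerι {A B : PointedConvexSpace.{w}} (f : A ⟶ B) {x : A.A} (hx : fn f x = zero B) :
    ∃ y, fn (kerι f) y = x := ⟨⟨x, hx⟩, rfl⟩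

theorem kerι_comp {A B : PointedConvexSpace.{w}} (f : A ⟶ B) : kerι f ≫ f = 0 :=
  hom_ext fun x => x.2

/-- Lifting along an injective homomorphism. -/
theorem exists_lift {A X Y : PointedConvexSpace.{w}} {i : X ⟶ Y}
    (hi : Function.Injective (fn i)) (f : A ⟶ Y) (h : ∀ a, ∃ x, fn i x = fn f a) :
    ∃ l : A ⟶ X, l ≫ i = f := by
  choose l hl using h
  refine ⟨homMk l fun t => hi ?_, hom_ext hl⟩
  rw [hl, fn_cmb, fn_cmb, SubDist.map_map]
  simp only [hl]

/-- Descending along a surjective homomorphism. -/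
theorem exists_desc {X Y Z : PointedConvexSpace.{w}} {p : X ⟶ Y}
    (hp : Function.Surjective (fn p)) (f : X ⟶ Z)
    (h : ∀ x x', fn p x = fn p x' → fn f x = fn f x') :
    ∃ d : Y ⟶ Z, p ≫ d = f := by
  choose s hs using hp
  have hd : ∀ x, fn f (s (fn p x)) = fn f x := fun x => h _ _ (hs _)
  refine ⟨homMk (fun y => fn f (s y)) fun t => ?_, hom_ext hd⟩
  have ht : t = SubDist.map (fn p) (SubDist.map s t) := by
    rw [SubDist.map_map]
    simp only [hs, SubDist.map_id']
  conv_lhs => rw [ht, ← fn_cmb, hd, fn_cmb, SubDist.map_map]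

theorem mono_of_injective {X Y : PointedConvexSpace.{w}} {i : X ⟶ Y}
    (hi : Function.Injective (fn i)) : Mono i :=
  ⟨fun f g h => hom_ext fun x => hi (by rw [← fn_comp, h, fn_comp])⟩

theorem epi_of_surjective {X Y : PointedConvexSpace.{w}} {p : X ⟶ Y}
    (hp : Function.Surjective (fn p)) : Epi p :=
  ⟨fun f g h => hom_ext fun y => by
    obtain ⟨x, rfl⟩ := hp y
    rw [← fn_comp, h, fn_comp]⟩

theorem nonempty_isLimit {X Y Z : PointedConvexSpace.{w}} {f : X ⟶ Y} {g : Y ⟶ Z}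
    (h : f ≫ g = 0) (hf : Function.Injective (fn f))
    (hr : ∀ y, fn g y = zero Z → ∃ x, fn f x = y) :
    Nonempty (IsLimit (KernelFork.ofι f h)) := by
  have := mono_of_injective hf
  have hl : ∀ {A : PointedConvexSpace.{w}} (k : A ⟶ Y), k ≫ g = 0 → ∃ l : A ⟶ X, l ≫ f = k := by
    intro A k hk
    refine exists_lift hf k fun a => hr _ ?_
    rw [← fn_comp, hk, fn_zero_hom]
  exact ⟨KernelFork.IsLimit.ofι' f h fun k hk => ⟨(hl k hk).choose, (hl k hk).choose_spec⟩⟩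

instance : HasKernels PointedConvexSpace.{w} where
  has_limit f := ⟨⟨_, (nonempty_isLimit (kerι_comp f) (kerι_injective f)
    fun _ => exists_kerι f).some⟩⟩

/-- Any kernel is isomorphic to the explicit one, so it inherits injectivity from `kerι`. -/
theorem injective_of_isLimit {X Y Z : PointedConvexSpace.{w}} {f : X ⟶ Y} {g : Y ⟶ Z}
    {h : f ≫ g = 0} (hl : IsLimit (KernelFork.ofι f h)) : Function.Injective (fn f) := by
  obtain ⟨l, hlf⟩ := KernelFork.IsLimit.lift' hl (kerι g) (kerι_comp g)
  obtain ⟨m, hm⟩ := exists_lift (kerι_injective g) f fun a => exists_kerι g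
    (by rw [← fn_comp, h, fn_zero_hom])
  have hml : m ≫ l = 𝟙 X := Fork.IsLimit.hom_ext hl (by
    rw [Category.assoc, hlf, hm, Category.id_comp]; rfl)
  have hmi : Function.Injective (fn m) := fun x x' hx => by
    have := congrArg (fn l) hx
    rwa [← fn_comp, ← fn_comp, hml] at this
  rw [← hm]
  exact (kerι_injective g).comp hmi

theorem exists_of_isLimit {X Y Z : PointedConvexSpace.{w}} {f : X ⟶ Y} {g : Y ⟶ Z}
    {h : f ≫ g = 0} (hl : IsLimit (KernelFork.ofι f h)) {y : Y.A} (hy : fn g y = zero Z) :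
    ∃ x, fn f x = y := by
  obtain ⟨l, hl⟩ := KernelFork.IsLimit.lift' hl (kerι g) (kerι_comp g)
  obtain ⟨k, rfl⟩ := exists_kerι g hy
  refine ⟨fn l k, ?_⟩
  rw [← fn_comp]
  exact congrArg (fun φ => fn φ k) hl

/-! ### Quotients -/

/-- Killing a combination of elements of `K` in a combination of elements of `A`. -/
def Kills (A : PointedConvexSpace.{w}) (K : Set A.A) (x y : A.A) : Prop :=
  ∃ u v : A.A →₀ ℝ≥0, totalMass A.A (u + v) ≤ 1 ∧ (v.support : Set A.A) ⊆ K ∧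
    x = ev A (u + v) ∧ y = ev A u

/-- The congruence generated by collapsing `K`. -/
def collapse (A : PointedConvexSpace.{w}) (K : Set A.A) : Setoid A.A :=
  Relation.EqvGen.setoid (Kills A K)

theorem Kills.refl {A : PointedConvexSpace.{w}} (K : Set A.A) (x : A.A) : Kills A K x x :=
  ⟨Finsupp.single x 1, 0, by simp [totalMass_single], by simp, by simp [ev_single_one],
    by simp [ev_single_one]⟩

theorem kills_zero {A : PointedConvexSpace.{w}} {K : Set A.A} {x : A.A} (hx : x ∈ K) :
    Kills A K x (zero A) :=
  ⟨0, Finsupp.single x 1, by simp [totalMass_single],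
    by simpa [Finsupp.support_single] using hx, by simp [ev_single_one], rfl⟩

/-- Combining the kept parts `u x` and the killed parts `v x` separately gives a single move, since
a combination of functions supported in `K` is supported in `K`. -/
theorem Kills.compat {A : PointedConvexSpace.{w}} {K : Set A.A} (t : A.A →₀ ℝ≥0)
    (ht : totalMass A.A t ≤ 1) {φ ψ : A.A → A.A} (h : ∀ x, Kills A K (φ x) (ψ x)) :
    Kills A K (ev A (t.mapDomain φ)) (ev A (t.mapDomain ψ)) := by
  choose u v hm hv hx hy using h
  have hu : ∀ x, totalMass A.A (u x) ≤ 1 := fun x =>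
    le_trans (by rw [map_add]; exact le_self_add) (hm x)
  have ht' : t.sum (fun _ r => r) ≤ 1 := (totalMass_apply t).symm.trans_le ht
  have hadd : Finsupp.linearCombination ℝ≥0 (fun x => u x + v x) t =
      Finsupp.linearCombination ℝ≥0 u t + Finsupp.linearCombination ℝ≥0 v t := by
    simp only [Finsupp.linearCombination_apply, smul_add, Finsupp.sum_add]
  refine ⟨Finsupp.linearCombination ℝ≥0 u t, Finsupp.linearCombination ℝ≥0 v t, ?_, ?_, ?_, ?_⟩
  · rw [← hadd, totalMass_linearCombination]
    exact (Finset.sum_le_sum fun x _ => mul_le_of_le_one_right' (hm x)).trans ht'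
  · rw [← Finsupp.mem_supported ℝ≥0, Finsupp.linearCombination_apply]
    exact Submodule.sum_mem _ fun x _ => Submodule.smul_mem _ _
      ((Finsupp.mem_supported ℝ≥0 _).mpr (hv x))
  · rw [← hadd, ← ev_bind A t ht' _ hm, funext hx]
  · rw [← ev_bind A t ht' _ hu, funext hy]

-- Chains at different entries may have different lengths and directions, so they cannot be run in
-- parallel. One entry is moved at a time, the others standing still by `Kills.refl`.
open Classical in
theorem collapse_compat_update {A : PointedConvexSpace.{w}} {K : Set A.A} (t : A.A →₀ ℝ≥0)
    (ht : totalMass A.A t ≤ 1) (φ : A.A → A.A) (a : A.A) {x y : A.A} (h : collapse A K x y) :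
    collapse A K (ev A (t.mapDomain (Function.update φ a x)))
      (ev A (t.mapDomain (Function.update φ a y))) := by
  induction h with
  | rel x y h =>
    refine .rel _ _ (Kills.compat t ht fun z => ?_)
    rcases eq_or_ne z a with rfl | hz
    · simpa using h
    · simpa [hz] using Kills.refl K (φ z)
  | refl x => exact .refl _
  | symm x y _ ih => exact .symm _ _ ih
  | trans x y z _ _ ih ih' => exact .trans _ _ _ ih ih'

open Classical in
theorem collapse_compat {A : PointedConvexSpace.{w}} {K : Set A.A} (t : A.A →₀ ℝ≥0)
    (ht : totalMass A.A t ≤ 1) (φ ψ : A.A → A.A) (h : ∀ x, collapse A K (φ x) (ψ x)) :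
    collapse A K (ev A (t.mapDomain φ)) (ev A (t.mapDomain ψ)) := by
  have key : ∀ s : Finset A.A,
      collapse A K (ev A (t.mapDomain φ)) (ev A (t.mapDomain (s.piecewise ψ φ))) := by
    intro s
    induction s using Finset.induction_on with
    | empty => rw [Finset.piecewise_empty]
    | insert a s ha ih =>
      refine .trans _ _ _ ih ?_
      have := collapse_compat_update t ht (s.piecewise ψ φ) a (h a)
      rwa [← Finset.piecewise_insert, ← Finset.piecewise_eq_of_notMem s ψ φ ha,
        Function.update_eq_self] at this
  have := key t.support
  rwa [Finsupp.mapDomain_congr fun x hx => Finset.piecewise_eq_of_mem t.support ψ φ hx] at this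

/-- The class of an element modulo the congruence collapsing `K`. -/
def cls (A : PointedConvexSpace.{w}) (K : Set A.A) (x : A.A) : Quotient (collapse A K) :=
  Quotient.mk _ x

/-- Replacing every entry by the chosen representative of its class does not change the class of a
combination. This makes the structure map of `quot` satisfy associativity and `proj` a homomorphism.
-/
theorem cls_cmb {A : PointedConvexSpace.{w}} (K : Set A.A) (t : SubDist A.A) :
    cls A K (cmb A t) = cls A K (cmb A (SubDist.map Quotient.out (SubDist.map (cls A K) t))) := by
  rw [SubDist.map_map, cmb_eq_ev, cmb_eq_ev]
  refine Quotient.sound ?_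
  have := collapse_compat (K := K) t.1 t.totalMass_le (fun x => x) (fun x => (cls A K x).out)
    fun x => (collapse A K).symm (Quotient.mk_out x)
  rwa [show t.1.mapDomain (fun x => x) = t.1 from Finsupp.mapDomain_id] at this

/-- The quotient collapsing a set to the base point. -/
noncomputable def quot (A : PointedConvexSpace.{w}) (K : Set A.A) : PointedConvexSpace.{w} :=
  mk (Quotient (collapse A K)) (fun t => cls A K (cmb A (SubDist.map Quotient.out t)))
    (fun x => by rw [SubDist.map_unit, cmb_unit]; exact Quotient.out_eq x)
    (fun T => by
      rw [SubDist.map_join, cmb_join, cls_cmb, SubDist.map_map, SubDist.map_map, SubDist.map_map,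
        SubDist.map_map])

/-- The projection to the quotient. -/
noncomputable def proj (A : PointedConvexSpace.{w}) (K : Set A.A) : A ⟶ quot A K :=
  homMk (B := quot A K) (cls A K) (cls_cmb K)

theorem proj_surjective (A : PointedConvexSpace.{w}) (K : Set A.A) :
    Function.Surjective (fn (proj A K)) := Quotient.mk_surjective

theorem collapse_of_proj_eq {A : PointedConvexSpace.{w}} {K : Set A.A} {x y : A.A}
    (h : fn (proj A K) x = fn (proj A K) y) : collapse A K x y := Quotient.exact h

theorem proj_eq_zero {A : PointedConvexSpace.{w}} {K : Set A.A} {x : A.A} (hx : x ∈ K) :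
    fn (proj A K) x = zero (quot A K) := by
  rw [← fn_zero (proj A K)]
  exact Quotient.sound (.rel _ _ (kills_zero hx))

/-- Homomorphisms that are zero on `K` identify elements congruent modulo `K`. -/
theorem fn_eq_of_collapse {A B : PointedConvexSpace.{w}} {K : Set A.A} (f : A ⟶ B)
    (hf : ∀ x ∈ K, fn f x = zero B) {x y : A.A} (h : collapse A K x y) : fn f x = fn f y := by
  induction h with
  | rel x y h =>
    obtain ⟨u, v, hm, hv, rfl, rfl⟩ := h
    have hu : totalMass A.A u ≤ 1 := le_trans (by rw [map_add]; exact le_self_add) hm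
    rw [fn_ev f hm, fn_ev f hu, Finsupp.mapDomain_add]
    have hz : v.mapDomain (fn f) = Finsupp.single (zero B) (totalMass A.A v) := by
      rw [Finsupp.mapDomain_congr (g := fun _ => zero B) fun x hx => hf x (hv hx),
        totalMass_apply, Finsupp.mapDomain, ← Finsupp.single_sum]
    rw [hz]
    -- The index `none` carries the mass of the killed part and is sent to the zero function, whose
    -- value is the base point; so this mass can be dropped. An extra index is needed because the
    -- base point may also occur among the images of the kept part.
    have h1 := ev_bind B (ι := Option B.A)
      (Finsupp.mapDomain some (u.mapDomain (fn f)) + Finsupp.single none (totalMass A.A v))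
      (by
        rw [Finsupp.sum_add_index' (fun _ => rfl) (fun _ _ _ => rfl),
          Finsupp.sum_mapDomain_index (fun _ => rfl) (fun _ _ _ => rfl),
          Finsupp.sum_mapDomain_index (fun _ => rfl) (fun _ _ _ => rfl),
          Finsupp.sum_single_index rfl, ← totalMass_apply, ← map_add]
        exact hm)
      (fun o => o.elim 0 fun b => Finsupp.single b 1)
      (by rintro (_ | b) <;> simp [totalMass_single])
    rw [map_add, Finsupp.linearCombination_mapDomain, Finsupp.mapDomain_add,
      ← Finsupp.mapDomain_comp, Finsupp.mapDomain_single] at h1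
    have hid : Finsupp.mapDomain (fun x => x) (u.mapDomain (fn f)) = u.mapDomain (fn f) :=
      Finsupp.mapDomain_id
    simpa [Function.comp_def, ev_single_one, Finsupp.linearCombination_apply, zero, hid] using h1
  | refl x => rfl
  | symm x y _ ih => exact ih.symm
  | trans x y z _ _ ih ih' => exact ih.trans ih'

theorem nonempty_isColimit {X Y Z : PointedConvexSpace.{w}} {f : X ⟶ Y} {g : Y ⟶ Z}
    (h : f ≫ g = 0) (hg : Function.Surjective (fn g))
    (hr : ∀ y y', fn g y = fn g y' → collapse Y (Set.range (fn f)) y y') :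
    Nonempty (IsColimit (CokernelCofork.ofπ g h)) := by
  have := epi_of_surjective hg
  have hd : ∀ {A : PointedConvexSpace.{w}} (k : Y ⟶ A), f ≫ k = 0 → ∃ l : Z ⟶ A, g ≫ l = k := by
    intro A k hk
    refine exists_desc hg k fun y y' hy => fn_eq_of_collapse k ?_ (hr y y' hy)
    rintro _ ⟨x, rfl⟩
    rw [← fn_comp, hk, fn_zero_hom]
  exact ⟨CokernelCofork.IsColimit.ofπ' g h fun k hk => ⟨(hd k hk).choose, (hd k hk).choose_spec⟩⟩

theorem comp_proj {X Y : PointedConvexSpace.{w}} (f : X ⟶ Y) :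
    f ≫ proj Y (Set.range (fn f)) = 0 := hom_ext fun x => proj_eq_zero ⟨x, rfl⟩

instance : HasCokernels PointedConvexSpace.{w} where
  has_colimit f := ⟨⟨_, (nonempty_isColimit (comp_proj f) (proj_surjective _ _)
    fun _ _ => collapse_of_proj_eq).some⟩⟩

theorem surjective_of_isColimit {X Y Z : PointedConvexSpace.{w}} {f : X ⟶ Y} {g : Y ⟶ Z}
    {h : f ≫ g = 0} (hc : IsColimit (CokernelCofork.ofπ g h)) : Function.Surjective (fn g) := by
  obtain ⟨d, hd⟩ := CokernelCofork.IsColimit.desc' hc (proj Y (Set.range (fn f))) (comp_proj f)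
  have hfg : ∀ x ∈ Set.range (fn f), fn g x = zero Z := by
    rintro _ ⟨x, rfl⟩
    rw [← fn_comp, h, fn_zero_hom]
  obtain ⟨e, he⟩ := exists_desc (proj_surjective Y (Set.range (fn f))) g fun y y' hy =>
    fn_eq_of_collapse g hfg (collapse_of_proj_eq hy)
  have hde : d ≫ e = 𝟙 Z := Cofork.IsColimit.hom_ext hc (by
    rw [← Category.assoc, hd, he]; exact (Category.comp_id g).symm)
  have hes : Function.Surjective (fn e) := fun z => ⟨fn d z, by rw [← fn_comp, hde]; rfl⟩
  rw [← he]
  exact hes.comp (proj_surjective _ _)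

theorem collapse_of_isColimit {X Y Z : PointedConvexSpace.{w}} {f : X ⟶ Y} {g : Y ⟶ Z}
    {h : f ≫ g = 0} (hc : IsColimit (CokernelCofork.ofπ g h)) {y y' : Y.A}
    (hy : fn g y = fn g y') : collapse Y (Set.range (fn f)) y y' := by
  obtain ⟨d, hd⟩ := CokernelCofork.IsColimit.desc' hc (proj Y (Set.range (fn f))) (comp_proj f)
  refine collapse_of_proj_eq ?_
  have := congrArg (fn d) hy
  rw [← fn_comp, ← fn_comp] at this
  rw [← hd]
  exact this

theorem hasZeroObject : HasZeroObject PointedConvexSpace.{w} := by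
  refine ⟨⟨mk PUnit (fun _ => ⟨⟩) (fun _ => rfl) (fun _ => rfl), ?_⟩⟩
  rw [IsZero.iff_id_eq_zero]
  exact hom_ext fun _ => rfl

/-! ### Collapsing inside a kernel -/

/-- Every finitely supported function is its mass times one of mass at most one. -/
theorem exists_ev_eq (A : PointedConvexSpace.{w}) {K : Set A.A} {v : A.A →₀ ℝ≥0}
    (hv : (v.support : Set A.A) ⊆ K) :
    ∃ v' : A.A →₀ ℝ≥0, totalMass A.A v' ≤ 1 ∧ (v'.support : Set A.A) ⊆ K ∧
      v = totalMass A.A v • v' := by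
  rcases eq_or_ne (totalMass A.A v) 0 with h0 | h0
  · refine ⟨0, by simp, by simp, ?_⟩
    rw [totalMass_apply, Finsupp.sum, Finset.sum_eq_zero_iff] at h0
    rw [smul_zero]
    ext x
    by_cases hx : x ∈ v.support
    · simp [h0 x hx]
    · simp [Finsupp.notMem_support_iff.mp hx]
  · refine ⟨(totalMass A.A v)⁻¹ • v, ?_, ?_, ?_⟩
    · rw [map_smul, smul_eq_mul, inv_mul_cancel₀ h0]
    · exact fun x hx => hv (Finsupp.support_smul hx)
    · rw [smul_smul, mul_inv_cancel₀ h0, one_smul]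

/-- Normalising the two parts of a move makes it binary; the killed part becomes a multiple of one
element `fn k a` because the image of `k` is closed under combinations. -/
theorem Kills.exists_bin {A U : PointedConvexSpace.{w}} {k : U ⟶ A} {x y : A.A}
    (h : Kills A (Set.range (fn k)) x y) :
    ∃ p z q a, p + q ≤ 1 ∧ x = bin A p z q (fn k a) ∧ y = sc A p z := by
  obtain ⟨u, v, hm, hv, rfl, rfl⟩ := h
  obtain ⟨u', hu', -, hu⟩ := exists_ev_eq A (Set.subset_univ (u.support : Set A.A))
  obtain ⟨v', hv', hvK, hv⟩ := exists_ev_eq A hv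
  rw [map_add] at hm
  have hva : ∃ a, fn k a = ev A v' := by
    have : Nonempty U.A := ⟨zero U⟩
    have hw : (v'.mapDomain (Function.invFun (fn k))).mapDomain (fn k) = v' := by
      rw [← Finsupp.mapDomain_comp]
      refine (Finsupp.mapDomain_congr (g := id) fun x hx => ?_).trans Finsupp.mapDomain_id
      exact Function.invFun_eq (hvK hx)
    exact ⟨ev U (v'.mapDomain (Function.invFun (fn k))), by
      rw [fn_ev k ((totalMass_mapDomain _ _).trans_le hv'), hw]⟩
  obtain ⟨a, ha⟩ := hva
  refine ⟨totalMass A.A u, ev A u', totalMass A.A v, a, hm, ?_, ?_⟩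
  · rw [ha, bin_ev A hm hu' hv', ← hu, ← hv]
  · rw [sc_ev A (le_self_add.trans hm) hu', ← hu]

theorem kills_bin {A : PointedConvexSpace.{w}} {K : Set A.A} {p q : ℝ≥0} (h : p + q ≤ 1)
    (z : A.A) {a : A.A} (ha : a ∈ K) : Kills A K (bin A p z q a) (sc A p z) :=
  ⟨_, _, by simpa [totalMass_single] using h,
    fun x hx => by
      rw [Finset.mem_singleton.mp (Finsupp.support_single_subset hx)]; exact ha, rfl, rfl⟩

/-- The congruence on the kernel of `h` collapsing a subspace is the restriction of the
corresponding congruence on the whole space: a single step. -/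
theorem collapse_of_kills {U X Y Z : PointedConvexSpace.{w}} {k : U ⟶ X} {j : X ⟶ Y} {h : Y ⟶ Z}
    (hj : Function.Injective (fn j)) (hjh : j ≫ h = 0)
    (hr : ∀ y, fn h y = zero Z → ∃ x, fn j x = y) {x x' : X.A}
    (hk : Kills Y (Set.range (fn (k ≫ j))) (fn j x) (fn j x')) :
    collapse X (Set.range (fn k)) x x' := by
  have hjz : ∀ x, fn h (fn j x) = zero Z := fun x => by rw [← fn_comp, hjh, fn_zero_hom]
  obtain ⟨p, z, q, a, hpq, hx, hx'⟩ := hk.exists_bin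
  have ha : fn k a ∈ Set.range (fn k) := ⟨a, rfl⟩
  have hp1 : p ≤ 1 := le_self_add.trans hpq
  -- Here `z` need not lie in `X`, but its coefficient is zero, so the base point of `X` can replace
  -- it.
  rcases eq_or_ne p 0 with rfl | hp
  · have h1 : x = bin X 0 (zero X) q (fn k a) := hj (by
      rw [hx, fn_bin j hpq, fn_comp]
      simp [bin])
    have h2 : x' = sc X 0 (zero X) := hj (by rw [hx', fn_sc j hp1, zero_sc, zero_sc])
    rw [h1, h2]
    exact .rel _ _ (kills_bin hpq _ ha)
  rcases eq_or_ne q 0 with rfl | hq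
  · have : x = x' := hj (by rw [hx, hx']; simp [bin, sc])
    rw [this]
  have hp0 : 0 < p := pos_iff_ne_zero.mpr hp
  have hq0 : 0 < q := pos_iff_ne_zero.mpr hq
  have hplt : p < 1 := (lt_add_of_pos_right p hq0).trans_le hpq
  have hz : sc Z p (fn h z) = zero Z := by rw [← fn_sc h hp1, ← hx', hjz]
  -- `s` is close enough to `1` for the coefficients below to have mass at most one
  obtain ⟨s, e, hse, hs0, hs1, hs2, hs3⟩ : ∃ s e : ℝ≥0, s + e = 1 ∧ 0 < s ∧ s < 1 ∧
      p * e ≤ s * q ∧ p + p * e ≤ s := by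
    -- The choice is `e = q / 2` and `s = 1 - q / 2`. Then `p + q ≤ 1` gives `p + e ≤ s`, from which
    -- both inequalities follow.
    obtain ⟨s, hse⟩ : ∃ s, s + q / 2 = 1 :=
      ⟨1 - q / 2, tsub_add_cancel_of_le (half_le_self zero_le |>.trans (le_add_self.trans hpq))⟩
    have he0 : 0 < q / 2 := half_pos hq0
    have hps : p + q / 2 ≤ s := by
      refine le_of_add_le_add_right (a := q / 2) ?_
      rwa [hse, add_assoc, add_halves]
    refine ⟨s, q / 2, hse, hp0.trans_le (le_self_add.trans hps),
      (lt_add_of_pos_right s he0).trans_eq hse, ?_, ?_⟩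
    · exact mul_le_mul' (le_self_add.trans hps) (half_le_self zero_le)
    · exact (add_le_add_right (mul_le_of_le_one_left' hp1) p).trans hps
  have hs : s ≠ 0 := hs0.ne'
  -- With `z₁ = s z` alone, `x = (p/s) z₁ + q a` could have mass above one. The point `z₂ = s z + e
  -- a` absorbs part of `a`: with `q' = q - (p/s) e`, the mass of `x = (p/s) z₂ + q' a` is still `p
  -- + q`. The two moves are `x → (p/s) z₂ = (p/s) z₁ + (p/s) e a → (p/s) z₁ = x'`.
  obtain ⟨z₁, hz₁⟩ := hr (sc Y s z) (by
    rw [fn_sc h hs1.le, sc_eq_zero_of_sc_eq_zero Z hp0 hplt hs1 hz])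
  obtain ⟨z₂, hz₂⟩ := hr (bin Y s z e (fn j (fn k a))) (by
    rw [fn_bin h hse.le, hjz, bin_zero_right Z hse.le,
      sc_eq_zero_of_sc_eq_zero Z hp0 hplt hs1 hz])
  obtain ⟨q', hq'⟩ : ∃ q', p / s * e + q' = q :=
    ⟨q - p / s * e, add_tsub_cancel_of_le (by
      rw [div_mul_eq_mul_div, div_le_iff₀ hs0, mul_comm q]; exact hs2)⟩
  have hps : p / s * s = p := div_mul_cancel₀ p hs
  have hm1 : p / s + q' ≤ 1 := by
    calc p / s + q' = p / s * (s + e) + q' := by rw [hse, mul_one]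
      _ = p + q := by rw [mul_add, hps, add_assoc, hq']
      _ ≤ 1 := hpq
  have hps1 : p / s ≤ 1 := le_self_add.trans hm1
  have hm2 : p / s + p / s * e ≤ 1 := by
    rw [div_mul_eq_mul_div, ← add_div]
    exact div_le_one_of_le₀ hs3 zero_le
  have e1 : x = bin X (p / s) z₂ q' (fn k a) := hj (by
    rw [hx, fn_bin j hm1, hz₂, fn_comp]
    have := bin_ev Y hm1 (v := Finsupp.single z s + Finsupp.single (fn j (fn k a)) e)
      (w := Finsupp.single (fn j (fn k a)) 1) (by simpa [totalMass_single] using hse.le)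
      (by simp [totalMass_single])
    rw [ev_single_one, ← bin.eq_def] at this
    rw [this, bin]
    simp only [smul_add, Finsupp.smul_single, smul_eq_mul, mul_one, hps, add_assoc,
      ← Finsupp.single_add, hq'])
  have e2 : sc X (p / s) z₂ = bin X (p / s) z₁ (p / s * e) (fn k a) := hj (by
    rw [fn_sc j hps1, fn_bin j hm2, hz₁, hz₂]
    have h1 := sc_ev Y hps1 (v := Finsupp.single z s + Finsupp.single (fn j (fn k a)) e)
      (by simpa [totalMass_single] using hse.le)
    have h2 := bin_ev Y hm2 (v := Finsupp.single z s)
      (w := Finsupp.single (fn j (fn k a)) 1) (by simpa [totalMass_single] using hs1.le)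
      (by simp [totalMass_single])
    rw [ev_single_one] at h2
    rw [bin.eq_def Y s, h1, sc.eq_def Y s, h2]
    simp)
  have e3 : x' = sc X (p / s) z₁ := hj (by
    rw [hx', fn_sc j hps1, hz₁, sc_sc Y hps1 hs1.le, hps])
  rw [e1, e3]
  refine .trans _ _ _ (.rel _ _ (kills_bin hm1 _ ha)) ?_
  rw [e2]
  exact .rel _ _ (kills_bin hm2 _ ha)

/-- The congruence on the kernel of `h` collapsing a subspace is the restriction of the
corresponding congruence on the whole space. -/
theorem collapse_of_collapse_ker {U X Y Z : PointedConvexSpace.{w}} {k : U ⟶ X} {j : X ⟶ Y}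
    {h : Y ⟶ Z} (hj : Function.Injective (fn j)) (hjh : j ≫ h = 0)
    (hr : ∀ y, fn h y = zero Z → ∃ x, fn j x = y) {x x' : X.A}
    (hc : collapse Y (Set.range (fn (k ≫ j))) (fn j x) (fn j x')) :
    collapse X (Set.range (fn k)) x x' := by
  have hK : ∀ y ∈ Set.range (fn (k ≫ j)), fn h y = zero Z := by
    rintro _ ⟨u, rfl⟩
    rw [← fn_comp, Category.assoc, hjh, comp_zero, fn_zero_hom]
  suffices H : ∀ y y', collapse Y (Set.range (fn (k ≫ j))) y y' →
      ∀ x x', fn j x = y → fn j x' = y' → collapse X (Set.range (fn k)) x x' from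
    H _ _ hc _ _ rfl rfl
  intro y y' hc
  induction hc with
  | rel y y' hk =>
    rintro x x' rfl rfl
    exact collapse_of_kills hj hjh hr hk
  | refl y =>
    intro x x' hx hx'
    rw [hj (hx.trans hx'.symm)]
  | symm y y' _ ih => exact fun x x' hx hx' => .symm _ _ (ih x' x hx' hx)
  | trans y y' y'' h₁ h₂ ih ih' =>
    intro x x' hx hx'
    -- The intermediate point lies in `X` because `h` is constant on congruence classes.
    obtain ⟨m, hm⟩ := hr y' (by
      rw [← fn_eq_of_collapse h hK h₁, ← hx, ← fn_comp, hjh, fn_zero_hom])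
    exact .trans _ _ _ (ih x m hx hm) (ih' m x' hm hx')

/-! ### The two closure axioms -/

theorem exists_isPullback {X Y Y' : PointedConvexSpace.{w}} (f : X ⟶ Y) (g : Y' ⟶ Y)
    (hf : IsStrictMono f) (hg : IsStrictEpi g) :
    ∃ (X' : PointedConvexSpace.{w}) (f' : X' ⟶ Y') (g' : X' ⟶ X),
      IsPullback f' g' g f ∧ IsStrictEpi g' := by
  obtain ⟨Z, p, hfp, ⟨hlf⟩, -⟩ := hf
  obtain ⟨U, k, hkg, ⟨hlk⟩, ⟨hcg⟩⟩ := hg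
  have hfi := injective_of_isLimit hlf
  have hki := injective_of_isLimit hlk
  have := mono_of_injective hfi
  set h := g ≫ p with hh
  have hji := kerι_injective h
  have := mono_of_injective hji
  have hlift : ∀ {W : PointedConvexSpace.{w}} (s : W ⟶ Y'), s ≫ h = 0 → ∃ l, l ≫ kerι h = s :=
    fun s hs => exists_lift hji s fun a => exists_kerι h (by rw [← fn_comp, hs, fn_zero_hom])
  obtain ⟨g', hg'⟩ : ∃ g' : ker h ⟶ X, g' ≫ f = kerι h ≫ g :=
    exists_lift hfi _ fun a => exists_of_isLimit hlf (by
      rw [← fn_comp, Category.assoc, ← hh, kerι_comp, fn_zero_hom])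
  obtain ⟨k', hk'⟩ := hlift k (by rw [hh, ← Category.assoc, hkg, zero_comp])
  have hk'g' : k' ≫ g' = 0 := by
    rw [← cancel_mono f, Category.assoc, hg', ← Category.assoc, hk', hkg, zero_comp]
  have hval : ∀ x, fn f (fn g' x) = fn g (fn (kerι h) x) := fun x => by
    rw [← fn_comp, hg', fn_comp]
  have hs0 : ∀ s : PullbackCone g f, s.fst ≫ h = 0 := fun s => by
    rw [hh, s.condition_assoc, hfp, comp_zero]
  refine ⟨ker h, kerι h, g', ⟨⟨hg'.symm⟩, ⟨PullbackCone.IsLimit.mk _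
    (fun s => (hlift s.fst (hs0 s)).choose)
    (fun s => (hlift s.fst (hs0 s)).choose_spec) (fun s => ?_) fun s m hm _ => ?_⟩⟩,
    U, k', hk'g', nonempty_isLimit _ ?_ ?_, nonempty_isColimit _ ?_ ?_⟩
  · rw [← cancel_mono f, Category.assoc, hg', ← Category.assoc, (hlift s.fst (hs0 s)).choose_spec,
      s.condition]
  · rw [← cancel_mono (kerι h), hm, (hlift s.fst (hs0 s)).choose_spec]
  · intro u u' huu
    apply hki
    rw [← hk', fn_comp, fn_comp, huu]
  · intro x hx
    obtain ⟨u, hu⟩ := exists_of_isLimit hlk (y := fn (kerι h) x) (by rw [← hval, hx, fn_zero])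
    exact ⟨u, hji (by rw [← fn_comp, hk', hu])⟩
  · intro x
    obtain ⟨y, hy⟩ := surjective_of_isColimit hcg (fn f x)
    obtain ⟨x', rfl⟩ := exists_kerι h (x := y) (by
      rw [hh, fn_comp, hy, ← fn_comp, hfp, fn_zero_hom])
    exact ⟨x', hfi (by rw [hval, hy])⟩
  -- Points with the same image under `g'` have the same image under `g`, hence are congruent in
  -- `Y'` because `g` is a cokernel of `k`; the congruence then restricts to `ker h`.
  · intro x x' hx
    refine collapse_of_collapse_ker hji (kerι_comp h) (fun y hy => exists_kerι h hy) ?_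
    rw [hk']
    exact collapse_of_isColimit hcg (by rw [← hval, ← hval, hx])

theorem exists_isPushout {X' X Y' : PointedConvexSpace.{w}} (f' : X' ⟶ Y') (g' : X' ⟶ X)
    (hf' : IsStrictMono f') (hg' : IsStrictEpi g') :
    ∃ (Y : PointedConvexSpace.{w}) (f : X ⟶ Y) (g : Y' ⟶ Y),
      IsPushout f' g' g f ∧ IsStrictMono f := by
  obtain ⟨Z, h, hfh, ⟨hlf⟩, ⟨hch⟩⟩ := hf'
  obtain ⟨U, k, hkg, -, ⟨hcg⟩⟩ := hg'
  have hfi := injective_of_isLimit hlf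
  have hgs := surjective_of_isColimit hcg
  have hhs := surjective_of_isColimit hch
  have := epi_of_surjective hgs
  have := epi_of_surjective hhs
  set K := Set.range (fn (k ≫ f'))
  have hps := proj_surjective Y' K
  have := epi_of_surjective hps
  have hdesc : ∀ {W : PointedConvexSpace.{w}} (s : Y' ⟶ W), (k ≫ f') ≫ s = 0 →
      ∃ d, proj Y' K ≫ d = s := fun s hs =>
    exists_desc hps s fun y y' hy => fn_eq_of_collapse s (by
      rintro _ ⟨u, rfl⟩
      rw [← fn_comp, hs, fn_zero_hom]) (collapse_of_proj_eq hy)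
  obtain ⟨f, hf⟩ := CokernelCofork.IsColimit.desc' hcg (f' ≫ proj Y' K) (by
    rw [← Category.assoc]; exact comp_proj _)
  replace hf : g' ≫ f = f' ≫ proj Y' K := hf
  obtain ⟨h', hh'⟩ := hdesc h (by rw [Category.assoc, hfh, comp_zero])
  have hfh' : f ≫ h' = 0 := by
    rw [← cancel_epi g', ← Category.assoc, hf, Category.assoc, hh', hfh, comp_zero]
  have hval : ∀ x, fn f (fn g' x) = fn (proj Y' K) (fn f' x) := fun x => by
    rw [← fn_comp, hf, fn_comp]
  have hs0 : ∀ s : PushoutCocone f' g', (k ≫ f') ≫ s.inl = 0 := fun s => by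
    rw [Category.assoc, s.condition, ← Category.assoc, hkg, zero_comp]
  have hcol : ∀ {W : PointedConvexSpace.{w}} (m : quot Y' K ⟶ W), f ≫ m = 0 →
      ∃ l, h' ≫ l = m := by
    intro W m hm
    obtain ⟨l, hl⟩ := CokernelCofork.IsColimit.desc' hch (proj Y' K ≫ m) (by
      rw [← Category.assoc, ← hf, Category.assoc, hm, comp_zero])
    refine ⟨l, ?_⟩
    rw [← cancel_epi (proj Y' K), ← Category.assoc, hh']
    exact hl
  have : Epi h' := epi_of_surjective fun z => by
    obtain ⟨y, rfl⟩ := hhs z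
    exact ⟨fn (proj Y' K) y, by rw [← fn_comp, hh']⟩
  refine ⟨quot Y' K, f, proj Y' K, ⟨⟨hf.symm⟩, ⟨PushoutCocone.IsColimit.mk _
    (fun s => (hdesc s.inl (hs0 s)).choose)
    (fun s => (hdesc s.inl (hs0 s)).choose_spec) (fun s => ?_) fun s m hm _ => ?_⟩⟩,
    Z, h', hfh', nonempty_isLimit _ ?_ ?_,
    ⟨CokernelCofork.IsColimit.ofπ' h' hfh' fun m hm =>
      ⟨(hcol m hm).choose, (hcol m hm).choose_spec⟩⟩⟩
  · rw [← cancel_epi g', ← Category.assoc, hf, Category.assoc, (hdesc s.inl (hs0 s)).choose_spec,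
      s.condition]
  · rw [← cancel_epi (proj Y' K), hm, (hdesc s.inl (hs0 s)).choose_spec]
  -- Injectivity of `f`: equality in the quotient is a congruence in `Y'` between points of `X'`. It
  -- descends to `X'`, where `g'` is constant on classes.
  · intro x₁ x₂ hx
    obtain ⟨x₁, rfl⟩ := hgs x₁
    obtain ⟨x₂, rfl⟩ := hgs x₂
    rw [hval, hval] at hx
    refine fn_eq_of_collapse g' ?_ (collapse_of_collapse_ker hfi hfh
      (fun y hy => exists_of_isLimit hlf hy) (collapse_of_proj_eq hx))
    rintro _ ⟨u, rfl⟩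
    rw [← fn_comp, hkg, fn_zero_hom]
  · intro y hy
    obtain ⟨y, rfl⟩ := hps y
    obtain ⟨x, rfl⟩ := exists_of_isLimit hlf (y := y) (by rw [← hh', fn_comp, hy])
    exact ⟨fn g' x, hval x⟩

end PointedConvexSpace

theorem mainTheorem12 : IsParabelian PointedConvexSpace.{w} := by
  exact ⟨inferInstance, PointedConvexSpace.hasZeroObject, inferInstance, inferInstance,
    fun _ _ _ f g => PointedConvexSpace.exists_isPullback f g,
    fun _ _ _ f' g' => PointedConvexSpace.exists_isPushout f' g'⟩
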